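/- **Setting.** Let $X$ be a (real or complex) Hilbert space, $U$ a Banach space over the same field, $A:\mathbb R_+\to L(X)$ and $B:\mathbb R_+\to L(U,X)$ continuous in operator norm with $\sup_{t\ge0}\|A(t)\|<\infty$ and $\sup_{t\ge 0}\|B(t)\|<\infty$. The input space $\mathcal U=PC(\mathbb R_+,U)$ consists of the globally bounded, right-continuous, piecewise continuous functions $u:\mathbb R_+\to U$, with norm $\|u\|_{\mathcal U}=\sup_{s\ge0}\|u(s)\|$. Consider the system $$\dot x(t)=A(t)x(t)+B(t)u(t),\quad t\ge t_0\ge 0,\qquad x(t_0)=x_0. \tag{1}$$ An evolution family generated by $A$ is a family $\{W(t,s)\}_{t\ge s\ge0}\subset L(X)$ with $W(s,s)=I$, $W(t,s)=W(t,r)W(r,s)$ for $t\ge r\ge s\ge 0$, $(t,s)\mapsto W(t,s)x$ continuous, $\partial_tW(t,s)x=A(t)W(t,s)x$ and $\partial_sW(t,s)x=-W(t,s)A(s)x$ for all $x\in X$. The mild solution of (1) is $$\phi(t,t_0,x_0,u)=W(t,t_0)x_0+\int_{t_0}^tW(t,\tau)B(\tau)u(\tau)\,d\tau .$$ **Comparison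 functions.** $\mathcal P$: continuous $\gamma:\mathbb R_+\to\mathbb R_+$ with $\gamma(0)=0$ and $\gamma(r)>0$ for $r>0$. $\mathcal K$: strictly increasing elements of $\mathcal P$. $\mathcal K_\infty$: unbounded elements of $\mathcal K$. $\mathcal{KL}$: continuous $\beta:\mathbb R_+^2\to\mathbb R_+$ with $\beta(\cdot,t)\in\mathcal K$ for every $t\ge0$ and $\beta(r,\cdot)$ strictly decreasing to $0$ for every $r>0$. **Stability notions.** System (1) is * *ISS* if there are $\beta\in\mathcal{KL}$, $\gamma\in\mathcal K$ with $\|\phi(t,t_0,x_0,u)\|\le\beta(\|x_0\|,t-t_0)+\gamma(\|u\|_{\mathcal U})$ for all $x_0\in X$, $u\in\mathcal U$, $t\ge t_0\ge0$; * *0-UGAS* if there is $\beta\in\mathcal{KL}$ with $\|\phi(t,t_0,x_0,0)\|\le\beta(\|x_0\|,t-t_0)$ for all $x_0\in X$, $t\ge t_0\ge0$; * *iISS* if there are $\alpha\in\mathcal K_\infty$, $\mu\in\mathcal K$, $\beta\in\mathcal{KL}$ with $\|\phi(t,t_0,x_0,u)\|\le\beta(\|x_0\|,t-t_0)+\alpha\big(\int_{t_0}^t\mu(\|u(s)\|)\,ds\big)$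 for all $x_0\in X$, $u\in\mathcal U$, $t\ge t_0\ge0$. $W$ is *uniformly asymptotically stable* if $\sup_{t\ge t_0\ge0}\|W(t,t_0)\|<\infty$ and for every $\varepsilon>0$ there is $T\ge 0$ with $\|W(t,t_0)\|\le\varepsilon$ for all $t_0\ge0$, $t\ge t_0+T$. It is *uniformly exponentially stable* if there are $k,\omega>0$ with $\|W(t,t_0)\|\le ke^{-\omega(t-t_0)}$ for all $t\ge t_0\ge0$. **Lyapunov functions.** For $V:\mathbb R_+\times X\to\mathbb R_+$ put $\dot V_u(t,x)=\limsup_{h\to0^+}\frac1h\big(V(t+h,\phi(t+h,t,x,u))-V(t,x)\big)\in[-\infty,\infty]$. Let $V$ be continuous with $V(t,0)=0$ and $\alpha_1(\|x\|)\le V(t,x)\le\alpha_2(\|x\|)$ for all $t\ge0$, $x\in X$ and some $\alpha_1,\alpha_2\in\mathcal K_\infty$. Then $V$ is an ISS Lyapunov function * *in implication form* if there are $\kappa\in\mathcal K$, $\mu\in\mathcal P$ such that for all $t\ge 0$, $x\in X$, $u\in\mathcal U$: $\|x\|\ge\kappa(\|u\|_{\mathcal U})$ implies $\dot V_u(t,x)\le-\mu(V(t,x))$;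 * *in dissipative form* if there are $\eta\in\mathcal P$, $\chi\in\mathcal K$ with $\dot V_u(t,x)\le-\eta(\|x\|)+\chi(\|u(t)\|)$ for all $t\ge 0$, $x\in X$, $u\in\mathcal U$, and $\lim_{\tau\to\infty}\eta(\tau)=\infty$ or $\liminf_{\tau\to\infty}\eta(\tau)\ge\lim_{\tau\to\infty}\chi(\tau)$. **Theorem.** $A$ generates an evolution family $W$, and for it the following statements are equivalent: 1. (1) is ISS. 2. (1) is 0-UGAS. 3. (1) is iISS. 4. $W$ is uniformly asymptotically stable. 5. $W$ is uniformly exponentially stable. 6. There is a continuously differentiable (in operator norm), bounded $P:\mathbb R_+\to L(X)$ with every $P(t)$ self-adjoint, $\langle P(t)x,x\rangle>0$ for $x\ne 0$, and $\langle P(t)x,x\rangle\ge\mu_0\|x\|^2$ for all $t\ge 0$, $x\in X$ and some $\mu_0>0$ independent of $t$ and $x$, such that $$A(t)^*P(t)+P(t)A(t)+\dot P(t)=-I,\qquad t\ge0,$$ and $V(t,x)=\langle P(t)x,x\rangle$ is an ISS Lyapunov function for (1) in implication form. 7. The same as 6, with "in dissipative form" in place of "in implication form". -/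

import Mathlib

open Set Filter Topology

namespace TVSys

/-! Functions of time live on `[0, ∞)`. They are written as functions on `ℝ`; only their values at
nonnegative times enter the definitions. -/

section Comparison

/-- Class `𝒫`: continuous on `[0, ∞)`, zero at zero, positive on `(0, ∞)`. -/
structure ClassP (γ : ℝ → ℝ) : Prop where
  continuousOn : ContinuousOn γ (Ici 0)
  map_zero : γ 0 = 0
  pos : ∀ r, 0 < r → 0 < γ r

/-- Class `𝒦`: strictly increasing members of `𝒫`. -/
structure ClassK (γ : ℝ → ℝ) : Prop extends ClassP γ where
  strictMonoOn : StrictMonoOn γ (Ici 0)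

/-- Class `𝒦_∞`: unbounded members of `𝒦`. -/
structure ClassKInf (γ : ℝ → ℝ) : Prop extends ClassK γ where
  unbounded : ¬ BddAbove (γ '' Ici 0)

/-- Class `ℒ`: nonnegative, continuous and strictly decreasing on `[0, ∞)`, with limit zero. -/
structure ClassL (γ : ℝ → ℝ) : Prop where
  nonneg : ∀ t, 0 ≤ t → 0 ≤ γ t
  continuousOn : ContinuousOn γ (Ici 0)
  strictAntiOn : StrictAntiOn γ (Ici 0)
  tendsto_zero : Tendsto γ atTop (𝓝 0)

/-- Class `𝒦ℒ`. -/
structure ClassKL (β : ℝ → ℝ → ℝ) : Prop where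
  continuousOn : ContinuousOn (fun p : ℝ × ℝ => β p.1 p.2) (Ici 0 ×ˢ Ici 0)
  classK : ∀ t, 0 ≤ t → ClassK (fun r => β r t)
  classL : ∀ r, 0 < r → ClassL (fun t => β r t)

end Comparison

section Inputs

variable {U : Type*} [NormedAddCommGroup U]

/-- The input space `PC(ℝ₊, U)`: globally bounded, right-continuous, piecewise continuous functions
(on every bounded interval finitely many discontinuities, at which the one-sided limits exist). -/
structure IsPC (u : ℝ → U) : Prop where
  bounded : ∃ M : ℝ, ∀ t, 0 ≤ t → ‖u t‖ ≤ M
  right_continuous : ∀ t, 0 ≤ t → ContinuousWithinAt u (Ici t) t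
  left_limit : ∀ t, 0 < t → ∃ l : U, Tendsto u (𝓝[<] t) (𝓝 l)
  finite_discontinuities : ∀ T : ℝ, {t ∈ Icc 0 T | ¬ ContinuousWithinAt u (Ici 0) t}.Finite

/-- The norm `sup_{s ≥ 0} ‖u(s)‖` of the input space. -/
noncomputable def inputNorm (u : ℝ → U) : ℝ := sSup ((fun s => ‖u s‖) '' Ici 0)

end Inputs

section Stability

/-! Stability notions of a forward complete control system with state space `X`, input space
`PC(ℝ₊, U)` and transition map `φ`, where `φ t t₀ x₀ u` is the state reached at time `t` from the
state `x₀` at time `t₀` under the input `u`. -/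

variable {X U : Type*} [NormedAddCommGroup X] [NormedAddCommGroup U]

/-- Input-to-state stability. -/
def ISS (φ : ℝ → ℝ → X → (ℝ → U) → X) : Prop :=
  ∃ β γ, ClassKL β ∧ ClassK γ ∧
    ∀ (x₀ : X) (u : ℝ → U), IsPC u → ∀ t₀ t : ℝ, 0 ≤ t₀ → t₀ ≤ t →
      ‖φ t t₀ x₀ u‖ ≤ β ‖x₀‖ (t - t₀) + γ (inputNorm u)

/-- Integral input-to-state stability. -/
def IISS (φ : ℝ → ℝ → X → (ℝ → U) → X) : Prop :=
  ∃ α μ β, ClassKInf α ∧ ClassK μ ∧ ClassKL β ∧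
    ∀ (x₀ : X) (u : ℝ → U), IsPC u → ∀ t₀ t : ℝ, 0 ≤ t₀ → t₀ ≤ t →
      ‖φ t t₀ x₀ u‖ ≤ β ‖x₀‖ (t - t₀) + α (∫ s in t₀..t, μ ‖u s‖)

/-- Uniform global asymptotic stability with zero input (0-UGAS). -/
def ZeroUGAS (φ : ℝ → ℝ → X → (ℝ → U) → X) : Prop :=
  ∃ β, ClassKL β ∧ ∀ (x₀ : X) (t₀ t : ℝ), 0 ≤ t₀ → t₀ ≤ t →
    ‖φ t t₀ x₀ 0‖ ≤ β ‖x₀‖ (t - t₀)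

/-- The Lie derivative of `V` at `(t, x)` for the input `u`: an upper right Dini derivative along the
trajectory, with values in the extended reals. -/
noncomputable def lieDeriv (φ : ℝ → ℝ → X → (ℝ → U) → X) (V : ℝ → X → ℝ)
    (u : ℝ → U) (t : ℝ) (x : X) : EReal :=
  limsup (fun h : ℝ => (((1 / h) * (V (t + h) (φ (t + h) t x u) - V t x) : ℝ) : EReal)) (𝓝[>] 0)

/-- What every coercive Lyapunov function candidate `V : ℝ₊ × X → ℝ₊` has to satisfy: it is
continuous, nonnegative, vanishes at `x = 0`, and lies between two `𝒦_∞` functions of the norm. -/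
structure IsCoerciveCandidate (V : ℝ → X → ℝ) : Prop where
  continuousOn : ContinuousOn (fun p : ℝ × X => V p.1 p.2) (Ici 0 ×ˢ univ)
  nonneg : ∀ t x, 0 ≤ t → 0 ≤ V t x
  map_zero : ∀ t, 0 ≤ t → V t 0 = 0
  sandwich : ∃ α₁ α₂, ClassKInf α₁ ∧ ClassKInf α₂ ∧
    ∀ t x, 0 ≤ t → α₁ ‖x‖ ≤ V t x ∧ V t x ≤ α₂ ‖x‖

/-- (Coercive) ISS Lyapunov function in implication form. -/
structure IsISSLyapunovImplication (φ : ℝ → ℝ → X → (ℝ → U) → X) (V : ℝ → X → ℝ) : Prop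
    extends IsCoerciveCandidate V where
  decay : ∃ κ μ, ClassK κ ∧ ClassP μ ∧
    ∀ (t : ℝ) (x : X) (u : ℝ → U), 0 ≤ t → IsPC u → κ (inputNorm u) ≤ ‖x‖ →
      lieDeriv φ V u t x ≤ ((-μ (V t x) : ℝ) : EReal)

/-- (Coercive) ISS Lyapunov function in dissipative form. Since `χ` is increasing, its `limsup` at
infinity is its limit, possibly `∞`. -/
structure IsISSLyapunovDissipative (φ : ℝ → ℝ → X → (ℝ → U) → X) (V : ℝ → X → ℝ) : Prop
    extends IsCoerciveCandidate V where
  decay : ∃ η χ, ClassP η ∧ ClassK χ ∧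
    (Tendsto η atTop atTop ∨
      limsup (fun τ => (χ τ : EReal)) atTop ≤ liminf (fun τ => (η τ : EReal)) atTop) ∧
    ∀ (t : ℝ) (x : X) (u : ℝ → U), 0 ≤ t → IsPC u →
      lieDeriv φ V u t x ≤ ((-η ‖x‖ + χ ‖u t‖ : ℝ) : EReal)

end Stability

section Evolution

variable {𝕜 X U : Type*} [RCLike 𝕜] [NormedAddCommGroup X] [NormedSpace 𝕜 X] [NormedSpace ℝ X]
  [NormedAddCommGroup U] [NormedSpace 𝕜 U]

/-- `W` is the strongly continuous evolution family `(W(t,s))_{t ≥ s ≥ 0}` generated by the family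
`A` of bounded operators; derivatives at the ends of the time intervals are one-sided. -/
structure IsEvolutionFamily (A : ℝ → X →L[𝕜] X) (W : ℝ → ℝ → X →L[𝕜] X) : Prop where
  self : ∀ s, 0 ≤ s → W s s = ContinuousLinearMap.id 𝕜 X
  comp : ∀ t r s, 0 ≤ s → s ≤ r → r ≤ t → W t s = (W t r).comp (W r s)
  strong_continuity : ∀ x : X,
    ContinuousOn (fun p : ℝ × ℝ => W p.1 p.2 x) {p | 0 ≤ p.2 ∧ p.2 ≤ p.1}
  deriv_left : ∀ (t s : ℝ) (x : X), 0 ≤ s → s ≤ t →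
    HasDerivWithinAt (fun τ => W τ s x) (A t (W t s x)) (Ici s) t
  deriv_right : ∀ (t s : ℝ) (x : X), 0 ≤ s → s ≤ t →
    HasDerivWithinAt (fun σ => W t σ x) (-(W t s (A s x))) (Icc 0 t) s

/-- The flow `φ(t, t₀, x₀, u) = W(t,t₀) x₀ + ∫_{t₀}^t W(t,τ) B(τ) u(τ) dτ` of mild solutions of
`ẋ = A(t) x + B(t) u`, where `W` is the evolution family generated by `A`. -/
noncomputable def mildFlow (W : ℝ → ℝ → X →L[𝕜] X) (B : ℝ → U →L[𝕜] X)
    (t t₀ : ℝ) (x₀ : X) (u : ℝ → U) : X :=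
  W t t₀ x₀ + ∫ τ in t₀..t, W t τ (B τ (u τ))

/-- Uniform stability. -/
def UniformlyStable (W : ℝ → ℝ → X →L[𝕜] X) : Prop :=
  ∃ N : ℝ, 0 < N ∧ ∀ t₀ t, 0 ≤ t₀ → t₀ ≤ t → ‖W t t₀‖ ≤ N

/-- Uniform attractivity. -/
def UniformlyAttractive (W : ℝ → ℝ → X →L[𝕜] X) : Prop :=
  ∀ ε : ℝ, 0 < ε → ∃ T : ℝ, 0 ≤ T ∧ ∀ t₀ t, 0 ≤ t₀ → t₀ + T ≤ t → ‖W t t₀‖ ≤ ε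

/-- Uniform asymptotic stability. -/
def UniformlyAsymptoticallyStable (W : ℝ → ℝ → X →L[𝕜] X) : Prop :=
  UniformlyStable W ∧ UniformlyAttractive W

/-- Uniform exponential stability. -/
def UniformlyExponentiallyStable (W : ℝ → ℝ → X →L[𝕜] X) : Prop :=
  ∃ k ω : ℝ, 0 < k ∧ 0 < ω ∧
    ∀ t₀ t, 0 ≤ t₀ → t₀ ≤ t → ‖W t t₀‖ ≤ k * Real.exp (-ω * (t - t₀))

end Evolution

section Lyapunov

variable {𝕜 X : Type*} [RCLike 𝕜] [NormedAddCommGroup X] [InnerProductSpace 𝕜 X] [CompleteSpace X]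

/-- The quadratic form `V(t,x) = ⟨P(t) x, x⟩`; it is real because `P(t)` will be self-adjoint. -/
noncomputable def quadForm (P : ℝ → X →L[𝕜] X) (t : ℝ) (x : X) : ℝ :=
  RCLike.re (inner 𝕜 (P t x) x)

/-- `P(t)` is self-adjoint with `⟨P(t) x, x⟩ > 0` for all `x ≠ 0`, for every `t ≥ 0`. -/
def IsPositiveFamily (P : ℝ → X →L[𝕜] X) : Prop :=
  ∀ t, 0 ≤ t → IsSelfAdjoint (P t) ∧ ∀ x : X, x ≠ 0 → 0 < quadForm P t x

/-- `P` is positive and `⟨P(t) x, x⟩ ≥ μ ‖x‖²` with one `μ > 0` for all `t ≥ 0`. -/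
def IsCoerciveFamily (P : ℝ → X →L[𝕜] X) : Prop :=
  IsPositiveFamily P ∧ ∃ μ : ℝ, 0 < μ ∧ ∀ t, 0 ≤ t → ∀ x : X, μ * ‖x‖ ^ 2 ≤ quadForm P t x

/-- `P : ℝ₊ → L(X)` is a continuously differentiable (in operator norm), bounded, positive, coercive
solution of `A(t)* P(t) + P(t) A(t) + Ṗ(t) = -I`, `t ≥ 0`. -/
structure IsLyapunovSolution [NormedSpace ℝ X] [IsScalarTower ℝ 𝕜 X]
    (A P : ℝ → X →L[𝕜] X) : Prop where
  contDiffOn : ContDiffOn ℝ 1 P (Ici 0)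
  bounded : ∃ M : ℝ, ∀ t, 0 ≤ t → ‖P t‖ ≤ M
  coercive : IsCoerciveFamily P
  equation : ∀ t, 0 ≤ t →
    (ContinuousLinearMap.adjoint (A t)).comp (P t) + (P t).comp (A t) + derivWithin P (Ici 0) t
      = -ContinuousLinearMap.id 𝕜 X

end Lyapunov

end TVSys

/-! By linearity, 0-UGAS is a statement about operator norms: evaluated on the unit sphere, it
bounds `W` uniformly and makes it decay uniformly. The cocycle law then iterates a contraction over
one fixed time span into exponential decay. Under exponential decay and bounded `B`, the
variation-of-constants integral is controlled both by the sup norm and by the time integral of the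
input norm, which gives ISS and iISS. Each of these returns 0-UGAS at zero input.

For the Lyapunov statements, exponential decay makes `P(t) = ∫_t^∞ W(τ,t)* W(τ,t) dτ` converge in
operator norm, uniformly bounded in `t`. Boundedness of `A` keeps trajectories away from the origin
for a uniform time, so `P` is coercive. Along solutions `V' = -‖x‖² + 2 Re⟨Px, Bu⟩`, and absorbing
the cross term gives both Lyapunov forms. Conversely, for zero input `V' = -‖x‖² ≤ -V/p` with `‖P‖ ≤
p`, and Grönwall together with coercivity recovers exponential decay.

Operator-norm regularity comes from a differentiable fundamental solution `Φ` with inverse `Ψ`: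
every evolution family generated by `A` equals `Φ(t)Ψ(s)` for `t ≥ s ≥ 0` (`evolution_eq`). -/

open MeasureTheory

namespace TVSys

/-! ### Global solutions of Lipschitz differential equations -/

section GlobalSolution

variable {E : Type*} [NormedAddCommGroup E] [NormedSpace ℝ E] [CompleteSpace E]

theorem exp_neg_mul_integral_exp_le {lam : ℝ} (hlam : 0 < lam) (a t : ℝ) :
    Real.exp (-(lam * t)) * ∫ τ in a..t, Real.exp (lam * τ) ≤ 1 / lam := by
  have h : ∫ τ in a..t, Real.exp (lam * τ) = (Real.exp (lam * t) - Real.exp (lam * a)) / lam := by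
    rw [intervalIntegral.integral_comp_mul_left (fun x => Real.exp x) hlam.ne']
    simp [integral_exp, div_eq_inv_mul]
  rw [h, Real.exp_neg]
  have := Real.exp_pos (lam * t)
  rw [mul_div_assoc', div_le_div_iff_of_pos_right hlam, mul_sub, inv_mul_cancel₀ this.ne']
  have : 0 < (Real.exp (lam * t))⁻¹ * Real.exp (lam * a) := by positivity
  linarith

/-- Global forward existence for a Lipschitz vector field that vanishes at the origin. -/
theorem exists_forall_hasDerivAt_of_lipschitz {v : ℝ → E → E} {K : ℝ}
    (hv : Continuous fun p : ℝ × E => v p.1 p.2) (hK : 0 ≤ K)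
    (hlip : ∀ t x y, ‖v t x - v t y‖ ≤ K * ‖x - y‖) (hzero : ∀ t, v t 0 = 0) (y₀ : E) :
    ∃ y : ℝ → E, y 0 = y₀ ∧ ∀ t, 0 ≤ t → HasDerivAt y (v t (y t)) t := by
  -- Picard iteration for the weighted unknown `z(t) = exp(-lam t) y(t)`: with `K / lam ≤ 1/2` it
  -- contracts on the whole half-line at once, so no local solutions need to be glued.
  obtain ⟨lam, hlam, hKlam⟩ : ∃ lam : ℝ, 0 < lam ∧ K * (1 / lam) ≤ 1 / 2 := by
    refine ⟨2 * (K + 1), by positivity, ?_⟩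
    rw [mul_one_div, div_le_div_iff₀ (by positivity) (by norm_num)]
    linarith
  let g : BoundedContinuousFunction ℝ E → ℝ → E := fun z τ => v τ (Real.exp (lam * τ) • z τ)
  have hg : ∀ z, Continuous (g z) := fun z => by
    have : Continuous fun τ => (τ, Real.exp (lam * τ) • z τ) := by fun_prop
    exact hv.comp this
  have hgi : ∀ z a b, IntervalIntegrable (g z) volume a b :=
    fun z a b => (hg z).intervalIntegrable a b
  have key : ∀ (f : ℝ → E) (C : ℝ), 0 ≤ C → (∀ τ, ‖f τ‖ ≤ K * (Real.exp (lam * τ) * C)) →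
      ∀ t, 0 ≤ t → ‖Real.exp (-(lam * t)) • ∫ τ in (0 : ℝ)..t, f τ‖ ≤ 1 / 2 * C := by
    intro f C hC hf t ht
    have h1 : ‖∫ τ in (0 : ℝ)..t, f τ‖ ≤ ∫ τ in (0 : ℝ)..t, K * (Real.exp (lam * τ) * C) :=
      intervalIntegral.norm_integral_le_of_norm_le ht (Eventually.of_forall fun τ _ => hf τ)
        (by apply Continuous.intervalIntegrable; fun_prop)
    rw [intervalIntegral.integral_const_mul, intervalIntegral.integral_mul_const] at h1
    rw [norm_smul, Real.norm_of_nonneg (Real.exp_pos _).le]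
    calc _ ≤ Real.exp (-(lam * t)) * (K * ((∫ τ in (0 : ℝ)..t, Real.exp (lam * τ)) * C)) := by gcongr
      _ = K * (Real.exp (-(lam * t)) * ∫ τ in (0 : ℝ)..t, Real.exp (lam * τ)) * C := by ring
      _ ≤ K * (1 / lam) * C := by
        gcongr
        exact exp_neg_mul_integral_exp_le hlam 0 t
      _ ≤ _ := by gcongr
  -- `max t 0` freezes the iterate at `y₀` for negative times, so that it is bounded and continuous
  -- on all of `ℝ`.
  let G : BoundedContinuousFunction ℝ E → ℝ → E := fun z t =>
    Real.exp (-(lam * max t 0)) • (y₀ + ∫ τ in (0 : ℝ)..max t 0, g z τ)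
  have hGcont : ∀ z, Continuous (G z) := fun z => by
    have : Continuous fun t => ∫ τ in (0 : ℝ)..t, g z τ :=
      intervalIntegral.continuous_primitive (hgi z) 0
    have h2 : Continuous fun t => ∫ τ in (0 : ℝ)..max t 0, g z τ :=
      this.comp (continuous_id.max continuous_const)
    fun_prop
  have hGbdd : ∀ z t, ‖G z t‖ ≤ ‖y₀‖ + 1 / 2 * ‖z‖ := fun z t => by
    simp only [G, smul_add]
    refine (norm_add_le _ _).trans (add_le_add ?_ ?_)
    · rw [norm_smul, Real.norm_of_nonneg (Real.exp_pos _).le]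
      refine mul_le_of_le_one_left (norm_nonneg _) (Real.exp_le_one_iff.2 ?_)
      have : 0 ≤ lam * max t 0 := by positivity
      linarith
    · refine key _ _ (norm_nonneg _) (fun τ => ?_) _ (le_max_right _ _)
      have := hlip τ (Real.exp (lam * τ) • z τ) 0
      rw [hzero, sub_zero, sub_zero, norm_smul, Real.norm_of_nonneg (Real.exp_pos _).le] at this
      refine this.trans ?_
      gcongr
      exact z.norm_coe_le_norm τ
  let T : BoundedContinuousFunction ℝ E → BoundedContinuousFunction ℝ E := fun z =>
    BoundedContinuousFunction.ofNormedAddCommGroup (G z) (hGcont z) _ (hGbdd z)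
  have hT : ContractingWith (1 / 2) T := by
    refine ⟨by rw [← NNReal.coe_lt_coe]; norm_num, LipschitzWith.of_dist_le_mul fun z w => ?_⟩
    rw [BoundedContinuousFunction.dist_le (by positivity)]
    intro t
    have : T z t - T w t =
        Real.exp (-(lam * max t 0)) • ∫ τ in (0 : ℝ)..max t 0, (g z τ - g w τ) := by
      rw [intervalIntegral.integral_sub (hgi z _ _) (hgi w _ _)]
      simp only [T, G, BoundedContinuousFunction.coe_ofNormedAddCommGroup, ← smul_sub]
      abel_nf
    rw [dist_eq_norm, this]
    have h := key (fun τ => g z τ - g w τ) (dist z w) dist_nonneg (fun τ => ?_) (max t 0)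
      (le_max_right _ _)
    · simpa using h
    · refine (hlip _ _ _).trans ?_
      rw [← smul_sub, norm_smul, Real.norm_of_nonneg (Real.exp_pos _).le, ← dist_eq_norm]
      gcongr
      exact BoundedContinuousFunction.dist_coe_le_dist τ
  obtain ⟨z, hz⟩ : ∃ z, T z = z := ⟨hT.fixedPoint, hT.fixedPoint_isFixedPt⟩
  -- The solution is the primitive without the truncation `max t 0`, hence differentiable from both
  -- sides at time `0` as well.
  refine ⟨fun t => y₀ + ∫ τ in (0 : ℝ)..t, g z τ, by simp, fun t ht => ?_⟩
  have h1 : HasDerivAt (fun t => y₀ + ∫ τ in (0 : ℝ)..t, g z τ) (g z t) t :=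
    (intervalIntegral.integral_hasDerivAt_right (hgi z _ _)
      ((hg z).stronglyMeasurableAtFilter _ _) (hg z).continuousAt).const_add _
  convert! h1 using 1
  have h2 : z t = Real.exp (-(lam * t)) • (y₀ + ∫ τ in (0 : ℝ)..t, g z τ) := by
    conv_lhs => rw [← hz]
    simp [T, G, max_eq_left ht]
  change v t _ = v t _
  rw [h2, smul_smul, ← Real.exp_add]
  simp

end GlobalSolution

/-! ### Fundamental solutions and their inverses -/

section Fundamental

variable {𝔸 : Type*} [NormedRing 𝔸] [NormedAlgebra ℝ 𝔸] [CompleteSpace 𝔸]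

/-- A fundamental solution of `Φ' = a Φ` on `[0, ∞)` together with its inverse. -/
structure IsFundamentalPair (a Φ Ψ : ℝ → 𝔸) : Prop where
  hasDerivAt_left : ∀ t, 0 ≤ t → HasDerivAt Φ (a t * Φ t) t
  hasDerivAt_right : ∀ t, 0 ≤ t → HasDerivAt Ψ (-(Ψ t * a t)) t
  mul_inv : ∀ t, 0 ≤ t → Φ t * Ψ t = 1
  inv_mul : ∀ t, 0 ≤ t → Ψ t * Φ t = 1

/-- `Φ` and `Ψ` solve separate linear equations. `ΨΦ` has derivative zero, but `ΦΨ` only satisfies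
`Y' = aY - Ya`, so `ΦΨ = 1` needs uniqueness for that equation. In a general Banach algebra a left
inverse need not be a right inverse. -/
theorem exists_isFundamentalPair {a : ℝ → 𝔸} (ha : Continuous a) {K : ℝ}
    (hK : ∀ t, ‖a t‖ ≤ K) : ∃ Φ Ψ : ℝ → 𝔸, IsFundamentalPair a Φ Ψ := by
  have hK0 : 0 ≤ K := (norm_nonneg _).trans (hK 0)
  obtain ⟨Φ, hΦ0, hΦ⟩ := exists_forall_hasDerivAt_of_lipschitz (v := fun t y => a t * y)
    (by fun_prop) hK0 (fun t x y => by
      rw [← mul_sub]; exact (norm_mul_le _ _).trans (by gcongr; exact hK t))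
    (fun t => mul_zero _) (1 : 𝔸)
  obtain ⟨Ψ, hΨ0, hΨ⟩ := exists_forall_hasDerivAt_of_lipschitz (v := fun t y => -(y * a t))
    (by fun_prop) hK0 (fun t x y => by
      rw [← neg_sub', norm_neg, ← sub_mul, mul_comm K]
      exact (norm_mul_le _ _).trans (by gcongr; exact hK t))
    (fun t => by simp) (1 : 𝔸)
  refine ⟨Φ, Ψ, hΦ, hΨ, fun t ht => ?_, fun t ht => ?_⟩
  · have hd : ∀ s, 0 ≤ s → HasDerivAt (fun r => Φ r * Ψ r)
        (a s * (Φ s * Ψ s) - (Φ s * Ψ s) * a s) s := fun s hs => by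
      convert! (hΦ s hs).mul (hΨ s hs) using 1
      noncomm_ring
    have h1 : ∀ s, HasDerivAt (fun _ : ℝ => (1 : 𝔸)) (a s * 1 - 1 * a s) s := fun s => by
      simpa using hasDerivAt_const s (1 : 𝔸)
    have := ODE_solution_unique (v := fun s y => a s * y - y * a s)
      (K := (2 * K).toNNReal) (a := 0) (b := t)
      (f := fun r => Φ r * Ψ r) (g := fun _ => 1)
      (fun s => LipschitzWith.of_dist_le_mul fun x y => by
        rw [dist_eq_norm, dist_eq_norm, Real.coe_toNNReal _ (by positivity)]
        have : a s * x - x * a s - (a s * y - y * a s) = a s * (x - y) - (x - y) * a s := by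
          noncomm_ring
        rw [this]
        have h1 := norm_mul_le (a s) (x - y)
        have h2 := norm_mul_le (x - y) (a s)
        have h3 := mul_le_mul_of_nonneg_right (hK s) (norm_nonneg (x - y))
        have h4 := norm_sub_le (a s * (x - y)) ((x - y) * a s)
        nlinarith)
      (fun s hs => (hd s hs.1).continuousAt.continuousWithinAt)
      (fun s hs => (hd s hs.1).hasDerivWithinAt) continuousOn_const
      (fun s hs => (h1 s).hasDerivWithinAt) (by simp [hΦ0, hΨ0])
    exact this (right_mem_Icc.2 ht)
  · have hd : ∀ s, 0 ≤ s → HasDerivAt (fun r => Ψ r * Φ r) 0 s := fun s hs => by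
      convert! (hΨ s hs).mul (hΦ s hs) using 1
      noncomm_ring
    have := constant_of_has_deriv_right_zero (a := 0) (b := t) (f := fun r => Ψ r * Φ r)
      (fun s hs => (hd s hs.1).continuousAt.continuousWithinAt)
      (fun s hs => (hd s hs.1).hasDerivWithinAt) t (right_mem_Icc.2 ht)
    simpa [hΦ0, hΨ0] using this

end Fundamental

end TVSys

namespace TVSys

section RealStructure

variable {𝕜 X : Type*} [RCLike 𝕜] [NormedAddCommGroup X] [NormedSpace 𝕜 X]
    [NormedSpace ℝ X] [IsScalarTower ℝ 𝕜 X]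

/-- The bounded operators over `𝕜` form a real normed algebra. -/
noncomputable abbrev realNormedAlgebra : NormedAlgebra ℝ (X →L[𝕜] X) :=
  { Algebra.ofModule (R := ℝ) (A := X →L[𝕜] X)
      (fun r S T => by ext x; rfl)
      (fun r S T => by
        ext x
        change S (r • T x) = r • S (T x)
        exact (S.restrictScalars ℝ).map_smul r (T x)) with
    norm_smul_le := fun r S => norm_smul_le r S }

theorem hasDerivWithinAt_apply {Y : ℝ → X →L[𝕜] X} {Y' : X →L[𝕜] X} {x : ℝ → X} {x' : X}
    {s : Set ℝ} {t : ℝ} (hY : HasDerivWithinAt Y Y' s t) (hx : HasDerivWithinAt x x' s t) :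
    HasDerivWithinAt (fun τ => Y τ (x τ)) (Y' (x t) + Y t x') s t := by
  have h := (ContinuousLinearMap.restrictScalarsL 𝕜 X X ℝ ℝ).hasFDerivAt.comp_hasDerivWithinAt t hY
  exact h.clm_apply hx

end RealStructure

/-! ### Evolution families in terms of the fundamental solution -/

section FundamentalSolution

variable {𝕜 X : Type*} [RCLike 𝕜] [NormedAddCommGroup X] [NormedSpace 𝕜 X]
    [NormedSpace ℝ X] [IsScalarTower ℝ 𝕜 X]

/-- Operator-norm fundamental solution of `Φ' = A Φ` on `[0, ∞)` and its inverse. -/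
structure IsFundamentalSolution (A Φ Ψ : ℝ → X →L[𝕜] X) : Prop where
  hasDerivAt_left : ∀ t, 0 ≤ t → HasDerivAt Φ (A t * Φ t) t
  hasDerivAt_right : ∀ t, 0 ≤ t → HasDerivAt Ψ (-(Ψ t * A t)) t
  mul_inv : ∀ t, 0 ≤ t → Φ t * Ψ t = 1
  inv_mul : ∀ t, 0 ≤ t → Ψ t * Φ t = 1

theorem exists_isFundamentalSolution [CompleteSpace X] {A : ℝ → X →L[𝕜] X}
    (hA : ContinuousOn A (Ici 0)) (hA_bdd : ∃ M : ℝ, ∀ t, 0 ≤ t → ‖A t‖ ≤ M) :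
    ∃ Φ Ψ : ℝ → X →L[𝕜] X, IsFundamentalSolution A Φ Ψ := by
  let _ := realNormedAlgebra (𝕜 := 𝕜) (X := X)
  obtain ⟨M, hM⟩ := hA_bdd
  have hc : Continuous fun t : ℝ => A (max t 0) :=
    hA.comp_continuous (continuous_id.max continuous_const) fun t => le_max_right t 0
  obtain ⟨Φ, Ψ, h⟩ := exists_isFundamentalPair hc fun t => hM _ (le_max_right t 0)
  refine ⟨Φ, Ψ, fun t ht => ?_, fun t ht => ?_, h.mul_inv, h.inv_mul⟩
  · simpa [max_eq_left ht] using h.hasDerivAt_left t ht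
  · simpa [max_eq_left ht] using h.hasDerivAt_right t ht

namespace IsFundamentalSolution

variable {A Φ Ψ : ℝ → X →L[𝕜] X}

theorem continuousOn_left (h : IsFundamentalSolution A Φ Ψ) : ContinuousOn Φ (Ici 0) :=
  fun t ht => (h.hasDerivAt_left t ht).continuousAt.continuousWithinAt

theorem continuousOn_right (h : IsFundamentalSolution A Φ Ψ) : ContinuousOn Ψ (Ici 0) :=
  fun t ht => (h.hasDerivAt_right t ht).continuousAt.continuousWithinAt

theorem apply_inv (h : IsFundamentalSolution A Φ Ψ) {t : ℝ} (ht : 0 ≤ t) (x : X) :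
    Φ t (Ψ t x) = x := DFunLike.congr_fun (h.mul_inv t ht) x

theorem isEvolutionFamily (h : IsFundamentalSolution A Φ Ψ) :
    IsEvolutionFamily A fun t s => Φ t * Ψ s where
  self s hs := h.mul_inv s hs
  comp t r s hs hsr hrt := by
    change Φ t * Ψ s = (Φ t * Ψ r) * (Φ r * Ψ s)
    rw [mul_assoc, ← mul_assoc (Ψ r), h.inv_mul r (hs.trans hsr), one_mul]
  strong_continuity x := by
    have h1 : ContinuousOn (fun p : ℝ × ℝ => Φ p.1) {p | 0 ≤ p.2 ∧ p.2 ≤ p.1} :=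
      h.continuousOn_left.comp continuousOn_fst fun p hp => hp.1.trans hp.2
    have h2 : ContinuousOn (fun p : ℝ × ℝ => Ψ p.2) {p | 0 ≤ p.2 ∧ p.2 ≤ p.1} :=
      h.continuousOn_right.comp continuousOn_snd fun p hp => hp.1
    exact (h1.mul h2).clm_apply continuousOn_const
  deriv_left t s x hs hst := by
    have := hasDerivWithinAt_apply (h.hasDerivAt_left t (hs.trans hst)).hasDerivWithinAt
      (hasDerivWithinAt_const t (Ici s) (Ψ s x))
    simpa using this
  deriv_right t s x hs hst := by
    have h1 := hasDerivWithinAt_apply (h.hasDerivAt_right s hs).hasDerivWithinAt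
      (hasDerivWithinAt_const s (Icc 0 t) x)
    have h2 := hasDerivWithinAt_apply (hasDerivWithinAt_const s (Icc 0 t) (Φ t)) h1
    simpa using h2

/-- Every evolution family generated by `A` is given by the fundamental solution. -/
theorem evolution_apply (h : IsFundamentalSolution A Φ Ψ) {W : ℝ → ℝ → X →L[𝕜] X}
    (hW : IsEvolutionFamily A W) {t s : ℝ} (hs : 0 ≤ s) (hst : s ≤ t) (x : X) :
    W t s x = Φ t (Ψ s x) := by
  -- `Ψ(τ) W(τ,s) x` is constant in `τ`: the terms `-ΨAW` and `ΨAW` of its derivative cancel.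
  have hd : ∀ r, s ≤ r → HasDerivWithinAt (fun τ => Ψ τ (W τ s x)) 0 (Ici s) r := fun r hr => by
    convert! hasDerivWithinAt_apply (h.hasDerivAt_right r (hs.trans hr)).hasDerivWithinAt
      (hW.deriv_left r s x hs hr) using 1
    simp
  have := constant_of_has_deriv_right_zero (a := s) (b := t)
    (fun r hr => (hd r hr.1).continuousWithinAt.mono Icc_subset_Ici_self)
    (fun r hr => (hd r hr.1).mono (Ici_subset_Ici.2 hr.1)) t (right_mem_Icc.2 hst)
  simp only [hW.self s hs, ContinuousLinearMap.id_apply] at this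
  rw [← this, h.apply_inv (hs.trans hst)]

theorem evolution_eq (h : IsFundamentalSolution A Φ Ψ) {W : ℝ → ℝ → X →L[𝕜] X}
    (hW : IsEvolutionFamily A W) {t s : ℝ} (hs : 0 ≤ s) (hst : s ≤ t) :
    W t s = Φ t * Ψ s := by
  ext x
  exact h.evolution_apply hW hs hst x

/-- Trajectories stay away from the origin for a uniform time. -/
theorem half_norm_le (h : IsFundamentalSolution A Φ Ψ) {M k : ℝ}
    (hM : ∀ t, 0 ≤ t → ‖A t‖ ≤ M) (hk : ∀ s t, 0 ≤ s → s ≤ t → ‖Φ t * Ψ s‖ ≤ k)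
    {t τ : ℝ} (ht : 0 ≤ t) (hτ : t ≤ τ) (hδ : M * k * (τ - t) ≤ 1 / 2) (x : X) :
    ‖x‖ / 2 ≤ ‖(Φ τ * Ψ t) x‖ := by
  have hW := h.isEvolutionFamily
  have hM0 := (norm_nonneg _).trans (hM 0 le_rfl)
  -- The speed is at most `M k ‖x‖`, so the displacement up to time `τ` is at most `‖x‖ / 2`.
  have hd := norm_image_sub_le_of_norm_deriv_right_le_segment (a := t) (b := τ)
    (f := fun σ => (Φ σ * Ψ t) x) (C := M * (k * ‖x‖))
    (fun σ hσ => (hW.deriv_left σ t x ht hσ.1).continuousWithinAt.mono Icc_subset_Ici_self)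
    (fun σ hσ => (hW.deriv_left σ t x ht hσ.1).mono (Ici_subset_Ici.2 hσ.1))
    (fun σ hσ => (A σ).le_of_opNorm_le_of_le (hM σ (ht.trans hσ.1))
      ((Φ σ * Ψ t).le_of_opNorm_le (hk t σ ht hσ.1) x)) τ (right_mem_Icc.2 hτ)
  rw [h.mul_inv t ht, one_apply_eq_self] at hd
  have h1 := norm_sub_norm_le x ((Φ τ * Ψ t) x)
  rw [norm_sub_rev] at h1
  have h2 := mul_le_mul_of_nonneg_right hδ (norm_nonneg x)
  linarith

end IsFundamentalSolution

end FundamentalSolution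

end TVSys

namespace TVSys

/-! ### Comparison functions and inputs -/

section ComparisonExamples

theorem classK_const_mul {c : ℝ} (hc : 0 < c) : ClassK fun r => c * r where
  continuousOn := by fun_prop
  map_zero := mul_zero c
  pos r hr := mul_pos hc hr
  strictMonoOn := fun _ _ _ _ h => mul_lt_mul_of_pos_left h hc

theorem classK_const_mul_sq {c : ℝ} (hc : 0 < c) : ClassK fun r => c * r ^ 2 where
  continuousOn := by fun_prop
  map_zero := by simp
  pos r hr := by positivity
  strictMonoOn := fun a ha b _ h => mul_lt_mul_of_pos_left (pow_lt_pow_left₀ h ha two_ne_zero) hc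

theorem classKInf_of_tendsto {γ : ℝ → ℝ} (h : ClassK γ) (ht : Tendsto γ atTop atTop) :
    ClassKInf γ where
  toClassK := h
  unbounded := by
    rintro ⟨M, hM⟩
    obtain ⟨r, hr, hr0⟩ := ((ht.eventually_gt_atTop M).and (eventually_ge_atTop 0)).exists
    exact hr.not_ge (hM (mem_image_of_mem γ hr0))

theorem classKInf_const_mul {c : ℝ} (hc : 0 < c) : ClassKInf fun r => c * r :=
  classKInf_of_tendsto (classK_const_mul hc) (tendsto_id.const_mul_atTop hc)

theorem classKInf_const_mul_sq {c : ℝ} (hc : 0 < c) : ClassKInf fun r => c * r ^ 2 :=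
  classKInf_of_tendsto (classK_const_mul_sq hc)
    ((tendsto_pow_atTop two_ne_zero).const_mul_atTop hc)

theorem classKL_mul_exp {k ω : ℝ} (hk : 0 < k) (hω : 0 < ω) :
    ClassKL fun r t => k * Real.exp (-ω * t) * r where
  continuousOn := by fun_prop
  classK t _ := classK_const_mul (mul_pos hk (Real.exp_pos _))
  classL r hr :=
    { nonneg := fun t _ => by positivity
      continuousOn := by fun_prop
      strictAntiOn := fun a _ b _ hab => by
        have : Real.exp (-ω * b) < Real.exp (-ω * a) := Real.exp_lt_exp.2 (by nlinarith)
        exact mul_lt_mul_of_pos_right (mul_lt_mul_of_pos_left this hk) hr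
      tendsto_zero := by
        have h : Tendsto (fun t : ℝ => -ω * t) atTop atBot :=
          tendsto_id.const_mul_atTop_of_neg (by linarith)
        simpa using ((Real.tendsto_exp_atBot.comp h).const_mul k).mul_const r }

end ComparisonExamples

section Inputs

variable {U : Type*} [NormedAddCommGroup U]

theorem isPC_zero : IsPC (0 : ℝ → U) where
  bounded := ⟨0, by simp⟩
  right_continuous _ _ := continuousWithinAt_const
  left_limit _ _ := ⟨0, tendsto_const_nhds⟩
  finite_discontinuities T := by
    have : {t ∈ Icc 0 T | ¬ ContinuousWithinAt (0 : ℝ → U) (Ici 0) t} = ∅ :=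
      eq_empty_of_forall_notMem fun t ht => ht.2 continuousWithinAt_const
    rw [this]
    exact finite_empty

theorem inputNorm_zero : inputNorm (0 : ℝ → U) = 0 := by
  have : (fun s : ℝ => ‖(0 : ℝ → U) s‖) '' Ici 0 = {0} := by
    simp
  rw [inputNorm, this, csSup_singleton]

theorem IsPC.norm_le_inputNorm {u : ℝ → U} (hu : IsPC u) {t : ℝ} (ht : 0 ≤ t) :
    ‖u t‖ ≤ inputNorm u := by
  obtain ⟨M, hM⟩ := hu.bounded
  refine le_csSup ⟨M, ?_⟩ (mem_image_of_mem (fun s => ‖u s‖) ht)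
  rintro _ ⟨s, hs, rfl⟩
  exact hM s hs

theorem inputNorm_nonneg (u : ℝ → U) : 0 ≤ inputNorm u :=
  Real.sSup_nonneg (by rintro _ ⟨s, -, rfl⟩; exact norm_nonneg _)

/-- A function that is continuous at all times at which an input is continuous, and bounded on a
compact time interval, is integrable there. -/
theorem IsPC.intervalIntegrable_of_continuousWithinAt {F : Type*} [NormedAddCommGroup F]
    {u : ℝ → U} (hu : IsPC u) {f : ℝ → F} {t₀ t C : ℝ} (h₀ : 0 ≤ t₀) (ht : t₀ ≤ t)
    (hf : ∀ s, 0 ≤ s → ContinuousWithinAt u (Ici 0) s → ContinuousWithinAt f (Ici 0) s)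
    (hC : ∀ s ∈ Icc t₀ t, ‖f s‖ ≤ C) : IntervalIntegrable f volume t₀ t := by
  rw [intervalIntegrable_iff_integrableOn_Icc_of_le ht]
  set D := {s ∈ Icc 0 t | ¬ ContinuousWithinAt u (Ici 0) s}
  have hfin : D.Finite := hu.finite_discontinuities t
  have hc : ContinuousOn f (Icc t₀ t \ D) := fun s hs => by
    have h0 : 0 ≤ s := h₀.trans hs.1.1
    refine (hf s h0 ?_).mono fun r hr => h₀.trans hr.1.1
    by_contra h
    exact hs.2 ⟨⟨h0, hs.1.2⟩, h⟩
  -- Continuity off a finite, hence null, set suffices for measurability.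
  have hm := hc.aestronglyMeasurable (μ := volume) (measurableSet_Icc.diff hfin.measurableSet)
  rw [Measure.restrict_congr_set (sdiff_null_ae_eq_self (hfin.measure_zero volume))] at hm
  refine ⟨hm, HasFiniteIntegral.of_bounded (C := C) ?_⟩
  filter_upwards [ae_restrict_mem measurableSet_Icc] with s hs using hC s hs

theorem IsPC.intervalIntegrable_norm {u : ℝ → U} (hu : IsPC u) {t₀ t : ℝ} (h₀ : 0 ≤ t₀)
    (ht : t₀ ≤ t) : IntervalIntegrable (fun s => ‖u s‖) volume t₀ t :=
  hu.intervalIntegrable_of_continuousWithinAt (C := inputNorm u) h₀ ht (fun _ _ h => h.norm)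
    fun s hs => by simpa using hu.norm_le_inputNorm (h₀.trans hs.1)

theorem IsPC.intervalIntegrable_clm_apply {𝕜 X : Type*} [RCLike 𝕜] [NormedAddCommGroup X]
    [NormedSpace 𝕜 X] [NormedSpace 𝕜 U] {u : ℝ → U} (hu : IsPC u) {L : ℝ → U →L[𝕜] X}
    (hL : ContinuousOn L (Ici 0)) {t₀ t : ℝ} (h₀ : 0 ≤ t₀) (ht : t₀ ≤ t) :
    IntervalIntegrable (fun s => L s (u s)) volume t₀ t := by
  obtain ⟨C, hC⟩ := isCompact_Icc.exists_bound_of_continuousOn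
    (hL.mono (Icc_subset_Ici_self.trans (Ici_subset_Ici.2 h₀)) : ContinuousOn L (Icc t₀ t))
  exact hu.intervalIntegrable_of_continuousWithinAt (C := C * inputNorm u) h₀ ht
    (fun s hs h => (hL s hs).clm_apply h)
    fun s hs => (L s).le_of_opNorm_le_of_le (hC s hs) (hu.norm_le_inputNorm (h₀.trans hs.1))

end Inputs

/-! ### Stability notions and exponential decay -/

section Stability

theorem ISS.zeroUGAS {X U : Type*} [NormedAddCommGroup X] [NormedAddCommGroup U]
    {φ : ℝ → ℝ → X → (ℝ → U) → X} (h : ISS φ) : ZeroUGAS φ := by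
  obtain ⟨β, γ, hβ, hγ, h⟩ := h
  refine ⟨β, hβ, fun x₀ t₀ t h₀ ht => ?_⟩
  simpa [inputNorm_zero, hγ.map_zero] using h x₀ 0 isPC_zero t₀ t h₀ ht

theorem IISS.zeroUGAS {X U : Type*} [NormedAddCommGroup X] [NormedAddCommGroup U]
    {φ : ℝ → ℝ → X → (ℝ → U) → X} (h : IISS φ) : ZeroUGAS φ := by
  obtain ⟨α, μ, β, hα, hμ, hβ, h⟩ := h
  refine ⟨β, hβ, fun x₀ t₀ t h₀ ht => ?_⟩
  simpa [hμ.map_zero, hα.map_zero] using h x₀ 0 isPC_zero t₀ t h₀ ht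

variable {𝕜 X U : Type*} [RCLike 𝕜] [NormedAddCommGroup X] [NormedSpace 𝕜 X]
  [NormedAddCommGroup U] [NormedSpace 𝕜 U]
  {A : ℝ → X →L[𝕜] X} {B : ℝ → U →L[𝕜] X} {W : ℝ → ℝ → X →L[𝕜] X}

theorem mildFlow_zero [NormedSpace ℝ X] (t t₀ : ℝ) (x₀ : X) :
    mildFlow W B t t₀ x₀ 0 = W t t₀ x₀ := by
  simp [mildFlow]

/-- By linearity, `β 1` bounds the operator norm of `W`. -/
theorem ZeroUGAS.uniformlyAsymptoticallyStable [NormedSpace ℝ X]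
    (h : ZeroUGAS (mildFlow W B)) : UniformlyAsymptoticallyStable W := by
  obtain ⟨β, hβ, h⟩ := h
  have hL := hβ.classL 1 one_pos
  have hW : ∀ t₀ t, 0 ≤ t₀ → t₀ ≤ t → ‖W t t₀‖ ≤ β 1 (t - t₀) := fun t₀ t h₀ ht => by
    have hs : 0 ≤ t - t₀ := sub_nonneg.2 ht
    refine ContinuousLinearMap.opNorm_le_of_unit_norm (hL.nonneg _ hs) fun x hx => ?_
    simpa [mildFlow_zero, hx] using h x t₀ t h₀ ht
  refine ⟨⟨β 1 0 + 1, ?_, fun t₀ t h₀ ht => ?_⟩, fun ε hε => ?_⟩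
  · linarith [hL.nonneg 0 le_rfl]
  · have := hL.strictAntiOn.antitoneOn self_mem_Ici (sub_nonneg.2 ht) (sub_nonneg.2 ht)
    linarith [hW t₀ t h₀ ht]
  · obtain ⟨T, hT⟩ := eventually_atTop.1 (hL.tendsto_zero.eventually_le_const hε)
    refine ⟨max T 0, le_max_right _ _, fun t₀ t h₀ ht => ?_⟩
    have h1 := le_max_left T 0
    have h2 := le_max_right T 0
    exact (hW t₀ t h₀ (by linarith)).trans (hT _ (by linarith))

/-- Every time span `T` contributes a factor `exp (-1)`. With `⌊(t - t₀) / T⌋₊` spans the rate is `1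
/ T`, and the factor `exp 1` in the constant pays for the incomplete last span. -/
theorem UniformlyAsymptoticallyStable.uniformlyExponentiallyStable
    (hcomp : ∀ t r s, 0 ≤ s → s ≤ r → r ≤ t → W t s = (W t r).comp (W r s))
    (h : UniformlyAsymptoticallyStable W) : UniformlyExponentiallyStable W := by
  obtain ⟨⟨N, hN, hW⟩, hattr⟩ := h
  obtain ⟨T, hT, hTW⟩ : ∃ T : ℝ, 0 < T ∧ ∀ t₀ t, 0 ≤ t₀ → t₀ + T ≤ t →
      ‖W t t₀‖ ≤ Real.exp (-1) := by
    obtain ⟨T, hT, h⟩ := hattr (Real.exp (-1)) (Real.exp_pos _)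
    -- Attractivity allows `T = 0`; the shift permits division by the span.
    exact ⟨T + 1, by linarith, fun t₀ t h₀ ht => h t₀ t h₀ (by linarith)⟩
  have hn : ∀ (n : ℕ) (t₀ t : ℝ), 0 ≤ t₀ → t₀ + n * T ≤ t → ‖W t t₀‖ ≤ N * Real.exp (-n) := by
    intro n
    induction n with
    | zero =>
      intro t₀ t h₀ ht
      simpa using hW t₀ t h₀ (by simpa using ht)
    | succ n ih =>
      intro t₀ t h₀ ht
      push_cast at ht ⊢
      have hnT : 0 ≤ n * T := by positivity
      rw [hcomp t (t₀ + T) t₀ h₀ (by linarith) (by linarith)]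
      calc _ ≤ ‖W t (t₀ + T)‖ * ‖W (t₀ + T) t₀‖ := ContinuousLinearMap.opNorm_comp_le _ _
        _ ≤ N * Real.exp (-n) * Real.exp (-1) := by
          gcongr
          · exact ih _ _ (by linarith) (by linarith)
          · exact hTW _ _ h₀ le_rfl
        _ = _ := by rw [mul_assoc, ← Real.exp_add, neg_add]
  refine ⟨N * Real.exp 1, 1 / T, by positivity, by positivity, fun t₀ t h₀ ht => ?_⟩
  have hq : 0 ≤ (t - t₀) / T := div_nonneg (sub_nonneg.2 ht) hT.le
  refine (hn ⌊(t - t₀) / T⌋₊ t₀ t h₀ ?_).trans ?_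
  · have := mul_le_mul_of_nonneg_right (Nat.floor_le hq) hT.le
    rw [div_mul_cancel₀ _ hT.ne'] at this
    linarith
  · rw [mul_assoc, ← Real.exp_add]
    gcongr
    have := Nat.lt_floor_add_one ((t - t₀) / T)
    have h2 : -(1 / T) * (t - t₀) = -((t - t₀) / T) := by ring
    rw [h2]
    linarith

theorem norm_integrand_le {k ω b : ℝ}
    (hW : ∀ t₀ t, 0 ≤ t₀ → t₀ ≤ t → ‖W t t₀‖ ≤ k * Real.exp (-ω * (t - t₀)))
    (hB : ∀ t, 0 ≤ t → ‖B t‖ ≤ b) (u : ℝ → U) {τ t : ℝ} (hτ : 0 ≤ τ) (ht : τ ≤ t) :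
    ‖W t τ (B τ (u τ))‖ ≤ k * Real.exp (-ω * (t - τ)) * (b * ‖u τ‖) :=
  (W t τ).le_of_opNorm_le_of_le (hW τ t hτ ht) ((B τ).le_of_opNorm_le (hB τ hτ) _)

theorem UniformlyExponentiallyStable.iss [NormedSpace ℝ X]
    (h : UniformlyExponentiallyStable W) (hB : ∃ M : ℝ, ∀ t, 0 ≤ t → ‖B t‖ ≤ M) : ISS (mildFlow W B) := by
  obtain ⟨k, ω, hk, hω, hW⟩ := h
  obtain ⟨b, hB⟩ := hB
  have hb : 0 ≤ b := (norm_nonneg _).trans (hB 0 le_rfl)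
  -- The gain is `k b` times the bound `1 / ω` on the integral of the exponential kernel; `+ 1`
  -- keeps it strictly increasing when `b = 0`.
  refine ⟨_, _, classKL_mul_exp hk hω, classK_const_mul (c := k * b * (1 / ω) + 1) (by positivity),
    fun x₀ u hu t₀ t h₀ ht => ?_⟩
  refine (norm_add_le _ _).trans (add_le_add ((W t t₀).le_of_opNorm_le (hW t₀ t h₀ ht) _) ?_)
  have hu0 := inputNorm_nonneg u
  have h1 : ‖∫ τ in t₀..t, W t τ (B τ (u τ))‖ ≤
      ∫ τ in t₀..t, k * b * inputNorm u * (Real.exp (-(ω * t)) * Real.exp (ω * τ)) := by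
    refine intervalIntegral.norm_integral_le_of_norm_le ht (Eventually.of_forall fun τ hτ => ?_)
      (by apply Continuous.intervalIntegrable; fun_prop)
    have hτ0 : 0 ≤ τ := h₀.trans hτ.1.le
    refine (norm_integrand_le hW hB u hτ0 hτ.2).trans ?_
    rw [← Real.exp_add, show -(ω * t) + ω * τ = -ω * (t - τ) by ring]
    have := mul_le_mul_of_nonneg_left (hu.norm_le_inputNorm hτ0)
      (show 0 ≤ k * Real.exp (-ω * (t - τ)) * b by positivity)
    linarith
  rw [intervalIntegral.integral_const_mul, intervalIntegral.integral_const_mul] at h1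
  have h2 := mul_le_mul_of_nonneg_left (exp_neg_mul_integral_exp_le hω t₀ t)
    (show 0 ≤ k * b * inputNorm u by positivity)
  linarith

theorem UniformlyExponentiallyStable.iiss [NormedSpace ℝ X]
    (h : UniformlyExponentiallyStable W) (hB : ∃ M : ℝ, ∀ t, 0 ≤ t → ‖B t‖ ≤ M) : IISS (mildFlow W B) := by
  obtain ⟨k, ω, hk, hω, hW⟩ := h
  obtain ⟨b, hB⟩ := hB
  have hb : 0 ≤ b := (norm_nonneg _).trans (hB 0 le_rfl)
  -- The kernel is at most `k`, so a linear `α` and the identity as `μ` suffice.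
  refine ⟨_, _, _, classKInf_const_mul (c := k * (b + 1)) (by positivity),
    classK_const_mul one_pos, classKL_mul_exp hk hω, fun x₀ u hu t₀ t h₀ ht => ?_⟩
  refine (norm_add_le _ _).trans (add_le_add ((W t t₀).le_of_opNorm_le (hW t₀ t h₀ ht) _) ?_)
  rw [← intervalIntegral.integral_const_mul]
  refine intervalIntegral.norm_integral_le_of_norm_le ht (Eventually.of_forall fun τ hτ => ?_)
    (by simpa using (hu.intervalIntegrable_norm h₀ ht).const_mul (k * (b + 1)))
  refine (norm_integrand_le hW hB u (h₀.trans hτ.1.le) hτ.2).trans ?_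
  have he : Real.exp (-ω * (t - τ)) ≤ 1 := Real.exp_le_one_iff.2 (by nlinarith [hτ.2])
  calc _ ≤ k * 1 * ((b + 1) * ‖u τ‖) := by gcongr; linarith
    _ = _ := by ring

end Stability

end TVSys

namespace TVSys

section Estimates

variable {𝕜 X U : Type*} [RCLike 𝕜] [NormedAddCommGroup X] [InnerProductSpace 𝕜 X]
  [NormedAddCommGroup U] [NormedSpace 𝕜 U]
  {P : ℝ → X →L[𝕜] X} {B : ℝ → U →L[𝕜] X}

theorem quadForm_le {p : ℝ} {t : ℝ} (hp : ‖P t‖ ≤ p) (x : X) : quadForm P t x ≤ p * ‖x‖ ^ 2 := by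
  refine (RCLike.re_le_norm _).trans ((norm_inner_le_norm _ _).trans ?_)
  have := mul_le_mul_of_nonneg_right ((P t).le_of_opNorm_le hp x) (norm_nonneg x)
  linarith

theorem two_mul_re_inner_le {p b : ℝ} {t : ℝ} (hp : ‖P t‖ ≤ p) (hb : ‖B t‖ ≤ b) (x : X) (v : U) :
    2 * RCLike.re (inner 𝕜 (P t x) (B t v)) ≤ 2 * (p * b) * ‖x‖ * ‖v‖ := by
  have hp0 := (norm_nonneg _).trans hp
  have h1 : RCLike.re (inner 𝕜 (P t x) (B t v)) ≤ (p * ‖x‖) * (b * ‖v‖) :=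
    (RCLike.re_le_norm _).trans ((norm_inner_le_norm _ _).trans (by
      gcongr
      · exact (P t).le_of_opNorm_le hp x
      · exact (B t).le_of_opNorm_le hb v))
  linarith

end Estimates

theorem mildFlow_self {𝕜 X U : Type*} [RCLike 𝕜] [NormedAddCommGroup X] [NormedSpace 𝕜 X]
    [NormedSpace ℝ X] [NormedAddCommGroup U] [NormedSpace 𝕜 U] {A : ℝ → X →L[𝕜] X}
    {W : ℝ → ℝ → X →L[𝕜] X} {B : ℝ → U →L[𝕜] X}
    (hW : IsEvolutionFamily A W) {t : ℝ} (ht : 0 ≤ t) (x : X) (u : ℝ → U) :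
    mildFlow W B t t x u = x := by
  simp [mildFlow, hW.self t ht]

/-! ### Quadratic Lyapunov functions -/

section Lyapunov

variable {𝕜 X U : Type*} [RCLike 𝕜] [NormedAddCommGroup X] [InnerProductSpace 𝕜 X]
  [CompleteSpace X] [NormedSpace ℝ X] [IsScalarTower ℝ 𝕜 X]
  [NormedAddCommGroup U] [NormedSpace 𝕜 U]
  {A P Φ Ψ : ℝ → X →L[𝕜] X} {W : ℝ → ℝ → X →L[𝕜] X} {B : ℝ → U →L[𝕜] X}

theorem hasDerivWithinAt_quadForm {P' : X →L[𝕜] X} {x : ℝ → X} {x' : X} {s : Set ℝ} {t : ℝ}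
    (hP : HasDerivWithinAt P P' s t) (hx : HasDerivWithinAt x x' s t)
    (hsa : IsSelfAdjoint (P t)) :
    HasDerivWithinAt (fun τ => quadForm P τ (x τ))
      (RCLike.re (inner 𝕜 (P' (x t)) (x t)) + 2 * RCLike.re (inner 𝕜 (P t (x t)) x')) s t := by
  have h := (RCLike.reCLM (K := 𝕜)).hasFDerivAt.comp_hasDerivWithinAt t
    ((hasDerivWithinAt_apply hP hx).inner 𝕜 hx)
  convert! h using 1
  have : inner 𝕜 (P t x') (x t) = inner 𝕜 x' (P t (x t)) := hsa.isSymmetric x' (x t)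
  rw [RCLike.reCLM_apply, map_add, inner_add_left, map_add, this, inner_re_symm x']
  ring

/-- The Lyapunov equation tested against `x`; self-adjointness of `P(t)` merges the two terms with
`A` into one. -/
theorem IsLyapunovSolution.re_inner_add (h : IsLyapunovSolution A P) {t : ℝ} (ht : 0 ≤ t)
    (x : X) : RCLike.re (inner 𝕜 (derivWithin P (Ici 0) t x) x)
      + 2 * RCLike.re (inner 𝕜 (P t x) (A t x)) = -‖x‖ ^ 2 := by
  have hsa : inner 𝕜 (P t (A t x)) x = inner 𝕜 (A t x) (P t x) :=
    (h.coercive.1 t ht).1.isSymmetric (A t x) x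
  have := congrArg (fun S : X →L[𝕜] X => RCLike.re (inner 𝕜 (S x) x)) (h.equation t ht)
  simp only [add_apply, ContinuousLinearMap.comp_apply, inner_add_left,
    map_add, neg_apply, ContinuousLinearMap.id_apply, inner_neg_left, map_neg,
    ContinuousLinearMap.adjoint_inner_left, hsa, inner_self_eq_norm_sq] at this
  rw [inner_re_symm (A t x)] at this
  linarith

/-- Derivative of the Lyapunov function along a curve with velocity `A(t) x + w`. -/
theorem IsLyapunovSolution.hasDerivWithinAt (h : IsLyapunovSolution A P) {x : ℝ → X} {w : X}
    {s : Set ℝ} {t : ℝ} (ht : 0 ≤ t) (hs : s ⊆ Ici 0)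
    (hx : HasDerivWithinAt x (A t (x t) + w) s t) :
    HasDerivWithinAt (fun τ => quadForm P τ (x τ))
      (-‖x t‖ ^ 2 + 2 * RCLike.re (inner 𝕜 (P t (x t)) w)) s t := by
  have hP := ((h.contDiffOn.differentiableOn one_ne_zero t ht).hasDerivWithinAt).mono hs
  convert! hasDerivWithinAt_quadForm hP hx (h.coercive.1 t ht).1 using 1
  rw [inner_add_right, map_add, ← h.re_inner_add ht (x t)]
  ring

theorem IsLyapunovSolution.exists_bound (h : IsLyapunovSolution A P) :
    ∃ p : ℝ, 0 < p ∧ ∀ t, 0 ≤ t → ‖P t‖ ≤ p := by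
  obtain ⟨M, hM⟩ := h.bounded
  exact ⟨M + 1, by linarith [(norm_nonneg _).trans (hM 0 le_rfl)],
    fun t ht => (hM t ht).trans (by linarith)⟩

theorem IsLyapunovSolution.uniformlyExponentiallyStable (h : IsLyapunovSolution A P)
    (hW : IsEvolutionFamily A W) : UniformlyExponentiallyStable W := by
  obtain ⟨p, hp, hP⟩ := h.exists_bound
  obtain ⟨μ, hμ, hcoer⟩ := h.coercive.2
  -- Square root of `μ ‖W(t,s)x‖² ≤ V(t) ≤ exp(-(t-s)/p) V(s) ≤ p exp(-(t-s)/p) ‖x‖²`.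
  refine ⟨√(p / μ), 1 / p / 2, by positivity, by positivity, fun s t hs hst => ?_⟩
  refine ContinuousLinearMap.opNorm_le_bound _ (by positivity) fun x => ?_
  have hd : ∀ τ, s ≤ τ → HasDerivWithinAt (fun τ => quadForm P τ (W τ s x))
      (-‖W τ s x‖ ^ 2) (Ici s) τ := fun τ hτ => by
    simpa using h.hasDerivWithinAt (w := 0) (hs.trans hτ) (Ici_subset_Ici.2 hs)
      (by simpa using hW.deriv_left τ s x hs hτ)
  have hV := le_gronwallBound_of_liminf_deriv_right_le (a := s) (b := t) (ε := 0)
    (K := -(1 / p)) (fun τ hτ => (hd τ hτ.1).continuousWithinAt.mono Icc_subset_Ici_self)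
    (fun τ hτ r hr => ((hd τ hτ.1).mono (Ici_subset_Ici.2 hτ.1)).liminf_right_slope_le hr)
    le_rfl
    (fun τ hτ => by
      have := quadForm_le (hP τ (hs.trans hτ.1)) (W τ s x)
      have h2 : 1 / p * quadForm P τ (W τ s x) ≤ ‖W τ s x‖ ^ 2 := by
        rw [one_div, inv_mul_le_iff₀ hp]; exact this
      linarith)
    t (right_mem_Icc.2 hst)
  rw [gronwallBound_ε0, hW.self s hs, ContinuousLinearMap.id_apply] at hV
  have h1 := hcoer t (hs.trans hst) (W t s x)
  have h2 := mul_le_mul_of_nonneg_right (quadForm_le (hP s hs) x)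
    (Real.exp_pos (-(1 / p) * (t - s))).le
  rw [← pow_le_pow_iff_left₀ (norm_nonneg _) (by positivity) two_ne_zero, mul_pow, mul_pow,
    Real.sq_sqrt (by positivity), ← Real.exp_nat_mul,
    show ((2 : ℕ) : ℝ) * (-(1 / p / 2) * (t - s)) = -(1 / p) * (t - s) by push_cast; ring,
    div_mul_eq_mul_div, div_mul_eq_mul_div, le_div_iff₀ hμ]
  linarith

/-- Pulling `Φ(t)` out leaves an integrand independent of `t`, so the flow can be differentiated by
the product rule and the fundamental theorem of calculus. -/
theorem IsFundamentalSolution.mildFlow_eq (h : IsFundamentalSolution A Φ Ψ)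
    (hW : IsEvolutionFamily A W) (hB : ContinuousOn B (Ici 0)) {u : ℝ → U} (hu : IsPC u)
    {t₀ t : ℝ} (h₀ : 0 ≤ t₀) (ht : t₀ ≤ t) (x : X) :
    mildFlow W B t t₀ x u = Φ t (Ψ t₀ x + ∫ τ in t₀..t, (Ψ τ).comp (B τ) (u τ)) := by
  have hi := hu.intervalIntegrable_clm_apply (h.continuousOn_right.clm_comp hB) h₀ ht
  rw [mildFlow, map_add, h.evolution_apply hW h₀ ht]
  congr 1
  refine Eq.trans ?_ (((Φ t).restrictScalars ℝ).intervalIntegral_comp_comm hi)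
  refine intervalIntegral.integral_congr fun τ hτ => ?_
  rw [uIcc_of_le ht] at hτ
  exact h.evolution_apply hW (h₀.trans hτ.1) hτ.2 _

/-- Right continuity of `u` yields the value `u t` even at a jump, since only the right derivative
is taken. -/
theorem IsFundamentalSolution.hasDerivWithinAt_mildFlow (h : IsFundamentalSolution A Φ Ψ)
    (hW : IsEvolutionFamily A W) (hB : ContinuousOn B (Ici 0)) {u : ℝ → U} (hu : IsPC u)
    {t : ℝ} (ht : 0 ≤ t) (x : X) :
    HasDerivWithinAt (fun τ => mildFlow W B τ t x u) (A t x + B t (u t)) (Ici t) t := by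
  have hL := h.continuousOn_right.clm_comp hB
  have hint : HasDerivWithinAt (fun τ => ∫ σ in t..τ, (Ψ σ).comp (B σ) (u σ))
      ((Ψ t).comp (B t) (u t)) (Ici t) t := by
    refine intervalIntegral.integral_hasDerivWithinAt_right (t := Ioi t) (by simp) ?_ ?_
    · have := (hu.intervalIntegrable_clm_apply hL ht (show t ≤ t + 1 by linarith)).1
      exact ⟨Ioc t (t + 1), Ioc_mem_nhdsGT (by linarith), this.aestronglyMeasurable⟩
    · exact (((hL t ht).mono (Ici_subset_Ici.2 ht)).clm_apply (hu.right_continuous t ht)).mono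
        Ioi_subset_Ici_self
  have hd := hasDerivWithinAt_apply (h.hasDerivAt_left t ht).hasDerivWithinAt
    (hint.const_add (Ψ t x))
  refine (hd.congr (fun τ hτ => h.mildFlow_eq hW hB hu ht hτ x)
    (h.mildFlow_eq hW hB hu ht le_rfl x)).congr_deriv ?_
  simp [h.apply_inv ht]

/-- The right derivative along the flow exists, so the `limsup` is a limit and the Lie derivative is
finite. -/
theorem IsLyapunovSolution.lieDeriv_eq (hP : IsLyapunovSolution A P)
    (h : IsFundamentalSolution A Φ Ψ) (hW : IsEvolutionFamily A W) (hB : ContinuousOn B (Ici 0))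
    {u : ℝ → U} (hu : IsPC u) {t : ℝ} (ht : 0 ≤ t) (x : X) :
    lieDeriv (mildFlow W B) (quadForm P) u t x =
      ((-‖x‖ ^ 2 + 2 * RCLike.re (inner 𝕜 (P t x) (B t (u t))) : ℝ) : EReal) := by
  have hx := mildFlow_self (B := B) hW ht x u
  have hd := hP.hasDerivWithinAt (x := fun τ => mildFlow W B τ t x u) (w := B t (u t)) ht
    (Ici_subset_Ici.2 ht) (by simpa only [hx] using h.hasDerivWithinAt_mildFlow hW hB hu ht x)
  have hlim := (hasDerivWithinAt_iff_tendsto_slope' self_notMem_Ioi).1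
    (hd.mono Ioi_subset_Ici_self)
  have hadd : Tendsto (fun h : ℝ => t + h) (𝓝[>] 0) (𝓝[>] t) := by
    simpa using tendsto_map (f := fun h : ℝ => t + h) (x := 𝓝[>] 0)
  replace hlim := hlim.comp hadd
  simp only [Function.comp_def, slope, vsub_eq_sub, smul_eq_mul, hx, add_sub_cancel_left,
    ← one_div] at hlim
  exact ((continuous_coe_real_ereal.tendsto _).comp hlim).limsup_eq

theorem IsLyapunovSolution.isCoerciveCandidate (hP : IsLyapunovSolution A P) :
    IsCoerciveCandidate (quadForm P) := by
  obtain ⟨p, hp, hPp⟩ := hP.exists_bound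
  obtain ⟨μ, hμ, hcoer⟩ := hP.coercive.2
  refine ⟨?_, fun t x ht => (by positivity : 0 ≤ μ * ‖x‖ ^ 2).trans (hcoer t ht x),
    fun t _ => by simp [quadForm], _, _, classKInf_const_mul_sq hμ, classKInf_const_mul_sq hp,
    fun t x ht => ⟨hcoer t ht x, quadForm_le (hPp t ht) x⟩⟩
  have h1 : ContinuousOn (fun q : ℝ × X => P q.1) (Ici 0 ×ˢ univ) :=
    hP.contDiffOn.continuousOn.comp continuousOn_fst fun q hq => hq.1
  exact RCLike.continuous_re.comp_continuousOn
    ((h1.clm_apply continuousOn_snd).inner continuousOn_snd)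

theorem IsLyapunovSolution.isISSLyapunovImplication (hP : IsLyapunovSolution A P)
    (h : IsFundamentalSolution A Φ Ψ) (hW : IsEvolutionFamily A W) (hB : ContinuousOn B (Ici 0))
    (hB_bdd : ∃ M : ℝ, ∀ t, 0 ≤ t → ‖B t‖ ≤ M) :
    IsISSLyapunovImplication (mildFlow W B) (quadForm P) where
  toIsCoerciveCandidate := hP.isCoerciveCandidate
  decay := by
    obtain ⟨p, hp, hPp⟩ := hP.exists_bound
    obtain ⟨b, hb⟩ := hB_bdd
    have hb0 : 0 ≤ b := (norm_nonneg _).trans (hb 0 le_rfl)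
    -- If `4 p b ‖u(t)‖ ≤ ‖x‖`, the cross term `2 p b ‖x‖ ‖u(t)‖` uses half of `-‖x‖²`; the other
    -- half is at most `-V / (2p)`.
    refine ⟨_, _, classK_const_mul (c := 4 * (p * b) + 1) (by positivity),
      (classK_const_mul (c := 1 / (2 * p)) (by positivity)).toClassP, fun t x u ht hu hκ => ?_⟩
    rw [hP.lieDeriv_eq h hW hB hu ht, EReal.coe_le_coe_iff]
    have h1 := two_mul_re_inner_le (hPp t ht) (hb t ht) x (u t)
    have h2 : 1 / (2 * p) * quadForm P t x ≤ ‖x‖ ^ 2 / 2 := by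
      rw [one_div, inv_mul_le_iff₀ (by positivity)]
      linarith [quadForm_le (hPp t ht) x]
    have h3 : 4 * (p * b) * ‖u t‖ ≤ ‖x‖ := by
      have := mul_le_mul_of_nonneg_left (hu.norm_le_inputNorm ht)
        (show 0 ≤ 4 * (p * b) by positivity)
      linarith [inputNorm_nonneg u]
    have h4 := mul_le_mul_of_nonneg_left h3 (norm_nonneg x)
    linarith

theorem IsLyapunovSolution.isISSLyapunovDissipative (hP : IsLyapunovSolution A P)
    (h : IsFundamentalSolution A Φ Ψ) (hW : IsEvolutionFamily A W) (hB : ContinuousOn B (Ici 0))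
    (hB_bdd : ∃ M : ℝ, ∀ t, 0 ≤ t → ‖B t‖ ≤ M) :
    IsISSLyapunovDissipative (mildFlow W B) (quadForm P) where
  toIsCoerciveCandidate := hP.isCoerciveCandidate
  decay := by
    obtain ⟨p, hp, hPp⟩ := hP.exists_bound
    obtain ⟨b, hb⟩ := hB_bdd
    have hb0 : 0 ≤ b := (norm_nonneg _).trans (hb 0 le_rfl)
    -- Young's inequality: `2 p b ‖x‖ ‖u‖ ≤ ‖x‖² / 2 + 2 (p b)² ‖u‖²`.
    refine ⟨_, _, (classK_const_mul_sq (c := 1 / 2) (by positivity)).toClassP,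
      classK_const_mul_sq (c := 2 * (p * b) ^ 2 + 1) (by positivity),
      Or.inl ((tendsto_pow_atTop two_ne_zero).const_mul_atTop (by positivity)),
      fun t x u ht hu => ?_⟩
    rw [hP.lieDeriv_eq h hW hB hu ht, EReal.coe_le_coe_iff]
    have h1 := two_mul_re_inner_le (hPp t ht) (hb t ht) x (u t)
    nlinarith [sq_nonneg (‖x‖ - 2 * (p * b) * ‖u t‖), sq_nonneg ‖u t‖]

end Lyapunov

end TVSys

namespace TVSys

/-! ### The Gramian as solution of the Lyapunov equation -/

section Gramian

variable {𝕜 X : Type*} [RCLike 𝕜] [NormedAddCommGroup X] [InnerProductSpace 𝕜 X]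
  [CompleteSpace X] [NormedSpace ℝ X] [IsScalarTower ℝ 𝕜 X]
  {A Φ Ψ : ℝ → X →L[𝕜] X} {W : ℝ → ℝ → X →L[𝕜] X}

/-- Real-linearity of the adjoint is what lets it be differentiated in time and moved through
integrals. -/
theorem starModule_real : StarModule ℝ (X →L[𝕜] X) where
  star_smul r S := by
    rw [← algebraMap_smul 𝕜 r S, star_smul, ← algebraMap_smul 𝕜 (star r) (star S)]
    simp

/-- The integrand `Φ* Φ` of the observability Gramian, extended continuously to negative times. -/
noncomputable def gramIntegrand (Φ : ℝ → X →L[𝕜] X) (t : ℝ) : X →L[𝕜] X :=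
  star (Φ (max t 0)) * Φ (max t 0)

/-- The solution `Ψ(t)* (∫_t^∞ Φ* Φ) Ψ(t)` of the Lyapunov equation. -/
noncomputable def gramian (Φ Ψ : ℝ → X →L[𝕜] X) (t : ℝ) : X →L[𝕜] X :=
  star (Ψ t) * (∫ τ in Ioi t, gramIntegrand Φ τ) * Ψ t

namespace IsFundamentalSolution

theorem continuous_gramIntegrand (h : IsFundamentalSolution A Φ Ψ) :
    Continuous (gramIntegrand Φ) := by
  have hc : Continuous fun t : ℝ => Φ (max t 0) :=
    h.continuousOn_left.comp_continuous (continuous_id.max continuous_const)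
      fun t => le_max_right t 0
  exact hc.star.mul hc

theorem integrableOn_gramIntegrand (h : IsFundamentalSolution A Φ Ψ) {k ω : ℝ} (hω : 0 < ω)
    (hk : ∀ t, 0 ≤ t → ‖Φ t‖ ≤ k * Real.exp (-ω * t)) (t : ℝ) :
    IntegrableOn (gramIntegrand Φ) (Ioi t) := by
  have h0 : IntegrableOn (gramIntegrand Φ) (Ioi 0) := by
    refine Integrable.mono' ((integrableOn_exp_mul_Ioi (a := -(2 * ω)) (by linarith) 0).const_mul
      (k ^ 2)) h.continuous_gramIntegrand.aestronglyMeasurable ?_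
    filter_upwards [ae_restrict_mem measurableSet_Ioi] with τ hτ
    have hτ : 0 ≤ τ := (mem_Ioi.1 hτ).le
    rw [gramIntegrand, max_eq_left hτ]
    calc _ = ‖Φ τ‖ * ‖Φ τ‖ := CStarRing.norm_star_mul_self
      _ ≤ (k * Real.exp (-ω * τ)) * (k * Real.exp (-ω * τ)) :=
        mul_self_le_mul_self (norm_nonneg _) (hk τ hτ)
      _ = k ^ 2 * (Real.exp (-ω * τ) * Real.exp (-ω * τ)) := by ring
      _ = _ := by rw [← Real.exp_add]; congr 2; ring
  refine ((h.continuous_gramIntegrand.integrableOn_Icc (a := t) (b := 0)).union h0).mono_set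
    fun τ hτ => ?_
  rcases le_or_gt τ 0 with h | h
  · exact Or.inl ⟨(mem_Ioi.1 hτ).le, h⟩
  · exact Or.inr h

theorem hasDerivAt_integral_gramIntegrand (h : IsFundamentalSolution A Φ Ψ)
    (hi : ∀ t, IntegrableOn (gramIntegrand Φ) (Ioi t)) (t : ℝ) :
    HasDerivAt (fun s => ∫ τ in Ioi s, gramIntegrand Φ τ) (-gramIntegrand Φ t) t := by
  have hc := h.continuous_gramIntegrand
  have heq : (fun s => ∫ τ in Ioi s, gramIntegrand Φ τ) =
      fun s => (∫ τ in Ioi 0, gramIntegrand Φ τ) - ∫ τ in (0 : ℝ)..s, gramIntegrand Φ τ := by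
    ext1 s
    rw [← intervalIntegral.integral_Ioi_sub_Ioi' (hi 0) (hi s), sub_sub_cancel]
  rw [heq]
  exact (intervalIntegral.integral_hasDerivAt_right (hc.intervalIntegrable _ _)
    (hc.stronglyMeasurableAtFilter _ _) hc.continuousAt).const_sub _

/-- Time enters only through the outer factors and the limit of integration, so no differentiation
under the integral is needed. The outer factors give `-A*P - PA`, and the limit gives `-(ΦΨ)*(ΦΨ) =
-1`. -/
theorem hasDerivAt_gramian (h : IsFundamentalSolution A Φ Ψ)
    (hi : ∀ t, IntegrableOn (gramIntegrand Φ) (Ioi t)) {t : ℝ} (ht : 0 ≤ t) :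
    HasDerivAt (gramian Φ Ψ) (-(star (A t) * gramian Φ Ψ t + gramian Φ Ψ t * A t + 1)) t := by
  let _ := realNormedAlgebra (𝕜 := 𝕜) (X := X)
  have := starModule_real (𝕜 := 𝕜) (X := X)
  have hΨ := h.hasDerivAt_right t ht
  have hd := (hΨ.star.mul (h.hasDerivAt_integral_gramIntegrand hi t)).mul hΨ
  refine hd.congr_deriv ?_
  have h1 : star (Ψ t) * gramIntegrand Φ t * Ψ t = 1 := by
    rw [gramIntegrand, max_eq_left ht]
    calc _ = star (Φ t * Ψ t) * (Φ t * Ψ t) := by rw [star_mul]; noncomm_ring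
      _ = 1 := by rw [h.mul_inv t ht, star_one, one_mul]
  rw [← h1, gramian, star_neg, star_mul]
  noncomm_ring

theorem isSelfAdjoint_gramian
    (hi : ∀ t, IntegrableOn (gramIntegrand Φ) (Ioi t)) (t : ℝ) : IsSelfAdjoint (gramian Φ Ψ t) := by
  have := starModule_real (𝕜 := 𝕜) (X := X)
  have h :=
    (starL' ℝ : (X →L[𝕜] X) ≃L[ℝ] (X →L[𝕜] X)).toContinuousLinearMap.integral_comp_comm (hi t)
  have hself : ∀ τ, star (gramIntegrand Φ τ) = gramIntegrand Φ τ := fun τ => by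
    rw [gramIntegrand, star_mul, star_star]
  have hS : star (∫ τ in Ioi t, gramIntegrand Φ τ) = ∫ τ in Ioi t, gramIntegrand Φ τ := by
    refine Eq.trans h.symm ?_
    exact integral_congr_ae (Eventually.of_forall hself)
  rw [isSelfAdjoint_iff, gramian, star_mul, star_mul, star_star, hS, mul_assoc]

/-- With `Ψ(t)` inside, the integrand is `W(τ,t)* W(τ,t)`, which admits bounds uniform in `t`;
`Ψ(t)` alone may grow. -/
theorem gramian_eq_integral (hi : ∀ t, IntegrableOn (gramIntegrand Φ) (Ioi t)) {t : ℝ} (ht : 0 ≤ t) :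
    IntegrableOn (fun τ => star (Φ τ * Ψ t) * (Φ τ * Ψ t)) (Ioi t) ∧
    gramian Φ Ψ t = ∫ τ in Ioi t, star (Φ τ * Ψ t) * (Φ τ * Ψ t) := by
  let _ := realNormedAlgebra (𝕜 := 𝕜) (X := X)
  have heq : EqOn (fun τ => star (Ψ t) * gramIntegrand Φ τ * Ψ t)
      (fun τ => star (Φ τ * Ψ t) * (Φ τ * Ψ t)) (Ioi t) := fun τ hτ => by
    simp only [gramIntegrand, max_eq_left (ht.trans (mem_Ioi.1 hτ).le), star_mul]
    noncomm_ring
  have hi1 : IntegrableOn (fun τ => star (Ψ t) * gramIntegrand Φ τ) (Ioi t) :=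
    Integrable.const_mul' (hi t) _
  have hi2 : IntegrableOn (fun τ => star (Ψ t) * gramIntegrand Φ τ * Ψ t) (Ioi t) :=
    Integrable.mul_const' hi1 _
  refine ⟨hi2.congr_fun heq measurableSet_Ioi, ?_⟩
  rw [← setIntegral_congr_fun measurableSet_Ioi heq, integral_mul_const_of_integrable hi1,
    integral_const_mul_of_integrable (hi t), gramian]

theorem quadForm_gramian (hi : ∀ t, IntegrableOn (gramIntegrand Φ) (Ioi t)) {t : ℝ} (ht : 0 ≤ t) (x : X) :
    IntegrableOn (fun τ => ‖(Φ τ * Ψ t) x‖ ^ 2) (Ioi t) ∧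
    quadForm (gramian Φ Ψ) t x = ∫ τ in Ioi t, ‖(Φ τ * Ψ t) x‖ ^ 2 := by
  obtain ⟨hint, heq⟩ := gramian_eq_integral hi ht
  -- The functional `S ↦ Re⟨x, Sx⟩` is continuous and real-linear, so it commutes with the integral.
  let ℓ : (X →L[𝕜] X) →L[ℝ] ℝ := (RCLike.reCLM (K := 𝕜)).comp
    (((innerSL 𝕜 x).restrictScalars ℝ).comp ((ContinuousLinearMap.apply 𝕜 X x).restrictScalars ℝ))
  have hℓ : ∀ S : X →L[𝕜] X, ℓ (star S * S) = ‖S x‖ ^ 2 := fun S => by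
    change RCLike.re (inner 𝕜 x (ContinuousLinearMap.adjoint S (S x))) = _
    rw [ContinuousLinearMap.adjoint_inner_right, inner_self_eq_norm_sq]
  have h1 := ℓ.integral_comp_comm hint
  have h2 := ℓ.integrable_comp hint
  simp only [hℓ] at h1 h2
  refine ⟨h2, ?_⟩
  rw [h1, quadForm, heq, inner_re_symm]
  rfl

theorem norm_gramian_le (hi : ∀ t, IntegrableOn (gramIntegrand Φ) (Ioi t)) {k ω : ℝ} (hω : 0 < ω)
    (hk : ∀ s t, 0 ≤ s → s ≤ t → ‖Φ t * Ψ s‖ ≤ k * Real.exp (-ω * (t - s))) {t : ℝ}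
    (ht : 0 ≤ t) : ‖gramian Φ Ψ t‖ ≤ k ^ 2 / (2 * ω) := by
  rw [(gramian_eq_integral hi ht).2]
  have hb : ∫ τ in Ioi t, k ^ 2 * Real.exp (2 * ω * t) * Real.exp (-(2 * ω) * τ) =
      k ^ 2 / (2 * ω) := by
    rw [integral_const_mul, integral_exp_mul_Ioi (by linarith), neg_div_neg_eq, mul_div_assoc',
      mul_assoc, ← Real.exp_add]
    simp
  rw [← hb]
  refine norm_integral_le_of_norm_le
    ((integrableOn_exp_mul_Ioi (a := -(2 * ω)) (by linarith) t).const_mul _) ?_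
  filter_upwards [ae_restrict_mem measurableSet_Ioi] with τ hτ
  calc _ = ‖Φ τ * Ψ t‖ * ‖Φ τ * Ψ t‖ := CStarRing.norm_star_mul_self
    _ ≤ (k * Real.exp (-ω * (τ - t))) * (k * Real.exp (-ω * (τ - t))) :=
      mul_self_le_mul_self (norm_nonneg _) (hk t τ ht (mem_Ioi.1 hτ).le)
    _ = k ^ 2 * (Real.exp (-ω * (τ - t)) * Real.exp (-ω * (τ - t))) := by ring
    _ = _ := by
      rw [← Real.exp_add, mul_assoc, ← Real.exp_add]
      ring_nf

/-- On `(t, t + δ]` the trajectory keeps norm at least `‖x‖ / 2`, so this piece alone contributes `δ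
‖x‖² / 4`. The length `δ` depends only on `M` and `k`. -/
theorem exists_coercive_gramian (h : IsFundamentalSolution A Φ Ψ)
    (hi : ∀ t, IntegrableOn (gramIntegrand Φ) (Ioi t)) {M k : ℝ}
    (hM : ∀ t, 0 ≤ t → ‖A t‖ ≤ M) (hk : ∀ s t, 0 ≤ s → s ≤ t → ‖Φ t * Ψ s‖ ≤ k) :
    ∃ μ : ℝ, 0 < μ ∧ ∀ t, 0 ≤ t → ∀ x : X, μ * ‖x‖ ^ 2 ≤ quadForm (gramian Φ Ψ) t x := by
  have hM0 := (norm_nonneg _).trans (hM 0 le_rfl)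
  have hk0 := (norm_nonneg _).trans (hk 0 0 le_rfl le_rfl)
  obtain ⟨δ, hδ, hδ'⟩ : ∃ δ : ℝ, 0 < δ ∧ M * k * δ ≤ 1 / 2 := by
    refine ⟨1 / (2 * (M * k + 1)), by positivity, ?_⟩
    rw [mul_one_div, div_le_div_iff₀ (by positivity) (by norm_num)]
    linarith
  refine ⟨δ / 4, by positivity, fun t ht x => ?_⟩
  obtain ⟨hint, heq⟩ := quadForm_gramian hi ht x
  have hsub : Ioc t (t + δ) ⊆ Ioi t := Ioc_subset_Ioi_self
  have h1 : ∫ τ in Ioc t (t + δ), ‖(Φ τ * Ψ t) x‖ ^ 2 ≤ quadForm (gramian Φ Ψ) t x := by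
    rw [heq]
    exact setIntegral_mono_set hint (Eventually.of_forall fun τ => by positivity)
      hsub.eventuallyLE
  have h2 : ∫ τ in Ioc t (t + δ), (‖x‖ / 2) ^ 2 ≤ ∫ τ in Ioc t (t + δ), ‖(Φ τ * Ψ t) x‖ ^ 2 := by
    refine setIntegral_mono_on (by simp) (hint.mono_set hsub) measurableSet_Ioc fun τ hτ => ?_
    have : M * k * (τ - t) ≤ 1 / 2 :=
      (mul_le_mul_of_nonneg_left (by linarith [hτ.2]) (by positivity)).trans hδ'
    have := h.half_norm_le hM hk ht hτ.1.le this x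
    gcongr
  rw [setIntegral_const, Real.volume_real_Ioc_of_le (by linarith), smul_eq_mul] at h2
  linarith

theorem isLyapunovSolution_gramian (h : IsFundamentalSolution A Φ Ψ) (hA : ContinuousOn A (Ici 0))
    (hA_bdd : ∃ M : ℝ, ∀ t, 0 ≤ t → ‖A t‖ ≤ M)
    (hexp : UniformlyExponentiallyStable fun t s => Φ t * Ψ s) :
    IsLyapunovSolution A (gramian Φ Ψ) := by
  obtain ⟨k, ω, hk, hω, hW⟩ := hexp
  obtain ⟨M, hM⟩ := hA_bdd
  -- `Φ 0` is not normalised to `1`, hence the factor `‖Φ 0‖` from `Φ t = Φ t * Ψ 0 * Φ 0`.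
  have hi := h.integrableOn_gramIntegrand (k := k * ‖Φ 0‖) hω fun t ht => by
    have h1 := hW 0 t le_rfl ht
    have h2 : Φ t = Φ t * Ψ 0 * Φ 0 := by rw [mul_assoc, h.inv_mul 0 le_rfl, mul_one]
    rw [h2]
    refine (norm_mul_le _ _).trans ?_
    have := mul_le_mul_of_nonneg_right h1 (norm_nonneg (Φ 0))
    rw [sub_zero] at this
    linarith
  have hd := fun t (ht : 0 ≤ t) => (h.hasDerivAt_gramian hi ht).hasDerivWithinAt (s := Ici 0)
  have hderiv : EqOn (derivWithin (gramian Φ Ψ) (Ici 0))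
      (fun t => -(star (A t) * gramian Φ Ψ t + gramian Φ Ψ t * A t + 1)) (Ici 0) :=
    fun t ht => (hd t ht).derivWithin (uniqueDiffOn_Ici 0 t ht)
  have hcont : ContinuousOn (gramian Φ Ψ) (Ici 0) := fun t ht => (hd t ht).continuousWithinAt
  obtain ⟨μ, hμ, hcoer⟩ := h.exists_coercive_gramian hi hM (k := k) fun s t hs hst =>
    (hW s t hs hst).trans (mul_le_of_le_one_right hk.le (Real.exp_le_one_iff.2 (by nlinarith)))
  refine ⟨?_, ⟨_, fun t ht => norm_gramian_le hi hω hW ht⟩,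
    ⟨fun t ht => ⟨isSelfAdjoint_gramian hi t, fun x hx => ?_⟩, μ, hμ, hcoer⟩, fun t ht => ?_⟩
  · rw [contDiffOn_one_iff_derivWithin (uniqueDiffOn_Ici 0)]
    refine ⟨fun t ht => (hd t ht).differentiableWithinAt, ContinuousOn.congr ?_ hderiv⟩
    -- The differential equation itself shows that the derivative is continuous, since `A` and the
    -- Gramian are.
    exact (((hA.star.mul hcont).add (hcont.mul hA)).add continuousOn_const).neg
  · have : 0 < ‖x‖ := norm_pos_iff.2 hx
    exact (by positivity : 0 < μ * ‖x‖ ^ 2).trans_le (hcoer t ht x)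
  · rw [hderiv ht]
    change star (A t) * gramian Φ Ψ t + gramian Φ Ψ t * A t + _ = -1
    have hcancel : ∀ S T : X →L[𝕜] X, S + T + -(S + T + 1) = -1 := fun S T => by abel
    exact hcancel _ _

end IsFundamentalSolution

end Gramian

end TVSys

theorem mainTheorem4 {𝕜 X U : Type*} [RCLike 𝕜]
    [NormedAddCommGroup X] [InnerProductSpace 𝕜 X] [CompleteSpace X]
    [NormedSpace ℝ X] [IsScalarTower ℝ 𝕜 X]
    [NormedAddCommGroup U] [NormedSpace 𝕜 U] [CompleteSpace U]
    (A : ℝ → X →L[𝕜] X) (hA : ContinuousOn A (Set.Ici 0))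
    (hA_bdd : ∃ M : ℝ, ∀ t, 0 ≤ t → ‖A t‖ ≤ M)
    (B : ℝ → U →L[𝕜] X) (hB : ContinuousOn B (Set.Ici 0))
    (hB_bdd : ∃ M : ℝ, ∀ t, 0 ≤ t → ‖B t‖ ≤ M) :
    (∃ W : ℝ → ℝ → X →L[𝕜] X, TVSys.IsEvolutionFamily A W) ∧
    ∀ W : ℝ → ℝ → X →L[𝕜] X, TVSys.IsEvolutionFamily A W →
      List.TFAE [
        TVSys.ISS (TVSys.mildFlow W B),
        TVSys.ZeroUGAS (TVSys.mildFlow W B),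
        TVSys.IISS (TVSys.mildFlow W B),
        TVSys.UniformlyAsymptoticallyStable W,
        TVSys.UniformlyExponentiallyStable W,
        ∃ P : ℝ → X →L[𝕜] X, TVSys.IsLyapunovSolution A P ∧
          TVSys.IsISSLyapunovImplication (TVSys.mildFlow W B) (TVSys.quadForm P),
        ∃ P : ℝ → X →L[𝕜] X, TVSys.IsLyapunovSolution A P ∧
          TVSys.IsISSLyapunovDissipative (TVSys.mildFlow W B) (TVSys.quadForm P)] := by
  obtain ⟨Φ, Ψ, h⟩ := TVSys.exists_isFundamentalSolution hA hA_bdd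
  refine ⟨⟨_, h.isEvolutionFamily⟩, fun W hW => ?_⟩
  -- The Gramian is built from `Φ` and `Ψ`; the decay of `W` transfers because `W(t,s) = Φ(t)Ψ(s)`.
  have hP : TVSys.UniformlyExponentiallyStable W →
      TVSys.IsLyapunovSolution A (TVSys.gramian Φ Ψ) := by
    rintro ⟨k, ω, hk, hω, hbound⟩
    refine h.isLyapunovSolution_gramian hA hA_bdd ⟨k, ω, hk, hω, fun t₀ t h₀ ht => ?_⟩
    simpa only [h.evolution_eq hW h₀ ht] using hbound t₀ t h₀ ht
  tfae_have 1 → 2 := TVSys.ISS.zeroUGAS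
  tfae_have 3 → 2 := TVSys.IISS.zeroUGAS
  tfae_have 2 → 4 := TVSys.ZeroUGAS.uniformlyAsymptoticallyStable
  tfae_have 4 → 5 := TVSys.UniformlyAsymptoticallyStable.uniformlyExponentiallyStable hW.comp
  tfae_have 5 → 1 := fun h5 => h5.iss hB_bdd
  tfae_have 5 → 3 := fun h5 => h5.iiss hB_bdd
  tfae_have 5 → 6 := fun h5 => ⟨_, hP h5, (hP h5).isISSLyapunovImplication h hW hB hB_bdd⟩
  tfae_have 5 → 7 := fun h5 => ⟨_, hP h5, (hP h5).isISSLyapunovDissipative h hW hB hB_bdd⟩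
  tfae_have 6 → 5 := fun ⟨_, hP, _⟩ => hP.uniformlyExponentiallyStable hW
  tfae_have 7 → 5 := fun ⟨_, hP, _⟩ => hP.uniformlyExponentiallyStable hW
  tfae_finish
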